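/- For real $n\times d$ matrices, call $A,A'$ \emph{neighbors} if they differ only in a single row $i$ and $\|A_{(i)}-A'_{(i)}\|_2\le 1$. A randomized algorithm $\mathsf{ALG}$ with values in a measurable space $\mathcal R$ is \emph{$(\epsilon,\delta)$-differentially private} if for all neighboring inputs $A,A'$ and all measurable $\mathcal S\subseteq\mathcal R$, $$\Pr[\mathsf{ALG}(A)\in\mathcal S]\le e^{\epsilon}\Pr[\mathsf{ALG}(A')\in\mathcal S]+\delta .$$ Consider the following algorithm with parameters $\epsilon,\delta,\eta,\nu>0$ and an $n\times d$ input matrix $A$. 1. Set $r=\left\lceil \frac{8\ln(2/\nu)}{\eta^2}\right\rceil$ and $w=\frac{16\sqrt{r\ln(2/\delta)}}{\epsilon}\,\ln\!\left(\frac{16r}{\delta}\right)$. 2. Subtract the mean row: $A\leftarrow A-\frac1n\mathbf 1\mathbf 1^{T}A$. 3. Compute a singular value decomposition $A=U\Sigma V^{T}$, with $U\in\mathbb R^{n\times n}$, $V\in\mathbb R^{d\times d}$ orthogonal and $\Sigma\in\mathbb R^{n\times d}$ nonnegative and zero off its main diagonal. 4. Set $B=U\sqrt{\Sigma^2+w^2I_{n\times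 d}}\;V^{T}$, i.e. replace each of the entries $\sigma$ of the main diagonal of $\Sigma$ (zeros included) by $\sqrt{\sigma^2+w^2}$. 5. Pick an $r\times n$ matrix $M$ whose entries are i.i.d. samples of $\mathcal N(0,1)$. 6. Return $\tilde C=\frac1r B^{T}M^{T}MB$. \textbf{Theorem.} Let $d\le n$, $0<\delta<2$, $0<\nu<2$, $\eta>0$ and $0<\epsilon\le\max\{1,\ln(2/\delta)\}$. Then, whichever singular value decomposition is chosen in step 3 for each matrix, the algorithm is $(\epsilon,\delta)$-differentially private. -/

import Mathlib

open MeasureTheory ProbabilityTheory Matrix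

/-- Real matrices carry the product (Borel) σ-algebra of their entries. -/
instance matrixMeasurableSpace (m k : ℕ) : MeasurableSpace (Matrix (Fin m) (Fin k) ℝ) :=
  inferInstanceAs (MeasurableSpace (Fin m → Fin k → ℝ))

/-- A randomized algorithm, given by the law of its output on every input, is
`(ε, δ)`-differentially private with respect to the neighboring relation `nbr`. -/
def IsDifferentiallyPrivate {X R : Type*} [MeasurableSpace R] (nbr : X → X → Prop)
    (alg : X → Measure R) (ε δ : ℝ) : Prop :=
  ∀ I I' : X, nbr I I' → ∀ S : Set R, MeasurableSet S →
    alg I S ≤ ENNReal.ofReal (Real.exp ε) * alg I' S + ENNReal.ofReal δ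

/-- Two matrices are neighbors if they differ only in one row `i`, by a vector whose Euclidean
norm is at most one. -/
def MatrixNeighbors {n d : ℕ} (A A' : Matrix (Fin n) (Fin d) ℝ) : Prop :=
  ∃ i : Fin n, (∀ j : Fin n, j ≠ i → A j = A' j) ∧ ‖WithLp.toLp 2 (A i - A' i)‖ ≤ 1

/-- `A = U * S * Vᵀ` with `U`, `V` orthogonal and `S` rectangular diagonal with a nonnegative
diagonal. The singular values may come in any order. -/
structure IsSVD {n d : ℕ} (A : Matrix (Fin n) (Fin d) ℝ) (U : Matrix (Fin n) (Fin n) ℝ)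
    (S : Matrix (Fin n) (Fin d) ℝ) (V : Matrix (Fin d) (Fin d) ℝ) : Prop where
  orthogonal_left : U ∈ Matrix.orthogonalGroup (Fin n) ℝ
  orthogonal_right : V ∈ Matrix.orthogonalGroup (Fin d) ℝ
  off_diag : ∀ (i : Fin n) (j : Fin d), (i : ℕ) ≠ (j : ℕ) → S i j = 0
  nonneg : ∀ (i : Fin n) (j : Fin d), 0 ≤ S i j
  eq : A = U * S * Vᵀ

/-- Every real matrix has a singular value decomposition. -/
theorem exists_isSVD {n d : ℕ} (A : Matrix (Fin n) (Fin d) ℝ) :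
    ∃ (U : Matrix (Fin n) (Fin n) ℝ) (S : Matrix (Fin n) (Fin d) ℝ)
      (V : Matrix (Fin d) (Fin d) ℝ), IsSVD A U S V := by
  classical
  let T := Matrix.toEuclideanLin A
  let hT := T.isSymmetric_adjoint_comp_self
  have hd : Module.finrank ℝ (EuclideanSpace ℝ (Fin d)) = d := by simp
  let v := hT.eigenvectorBasis hd
  let σ : ℕ → ℝ := fun i => T.singularValues i
  have hσ0 : ∀ i, 0 ≤ σ i := T.singularValues_nonneg
  have hin : ∀ i j : Fin d, inner ℝ (T (v i)) (T (v j)) = if i = j then σ j ^ 2 else 0 := by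
    intro i j
    have h := hT.apply_eigenvectorBasis hd j
    rw [← LinearMap.adjoint_inner_right]
    change inner ℝ (v i) ((LinearMap.adjoint T ∘ₗ T) (v j)) = _
    rw [h, inner_smul_right, ← T.sq_singularValues_fin hd,
      orthonormal_iff_ite.mp v.orthonormal i j]
    split_ifs <;> simp [σ]
  have hker : ∀ j : Fin d, σ j = 0 → T (v j) = 0 := by
    intro j hj
    have h := hin j j
    rw [if_pos rfl, hj] at h
    exact (inner_self_eq_zero (𝕜 := ℝ)).mp (h.trans (by simp))
  have hlt : ∀ j : ℕ, 0 < σ j → j < n := by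
    intro j hj
    have h1 := T.singularValues_pos_iff_lt_finrank_range.mp hj
    have h2 := Submodule.finrank_le (LinearMap.range T)
    simp only [finrank_euclideanSpace, Fintype.card_fin] at h2
    omega
  let x : Fin n → EuclideanSpace ℝ (Fin n) := fun i =>
    if h : (i : ℕ) < d then (σ i)⁻¹ • T (v ⟨i, h⟩) else 0
  let s : Set (Fin n) := {i | (i : ℕ) < d ∧ 0 < σ i}
  have hx : Orthonormal ℝ (s.domRestrict x) := by
    rw [orthonormal_iff_ite]
    rintro ⟨i, hi, hi0⟩ ⟨j, hj, hj0⟩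
    simp only [Set.domRestrict_apply, x, hi, hj, dif_pos, inner_smul_left, inner_smul_right, hin,
      Subtype.mk.injEq, Fin.mk.injEq, Fin.val_inj]
    split_ifs with h
    · subst h
      simp
      field_simp
    · simp
  obtain ⟨u, hu⟩ := hx.exists_orthonormalBasis_extension_of_card_eq (by simp)
  have hTv : ∀ j : Fin d, ∀ h : (j : ℕ) < n, T (v j) = σ j • u ⟨j, h⟩ := by
    intro j h
    rcases (hσ0 j).eq_or_lt with h0 | h0
    · rw [hker j h0.symm, ← h0, zero_smul]
    · rw [hu ⟨j, h⟩ ⟨j.2, h0⟩]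
      simp [x, smul_smul, h0.ne']
  have horth : ∀ {m : ℕ} (b : OrthonormalBasis (Fin m) ℝ (EuclideanSpace ℝ (Fin m))),
      (Matrix.of fun k i => b i k : Matrix (Fin m) (Fin m) ℝ) ∈
        Matrix.orthogonalGroup (Fin m) ℝ := by
    intro m b
    rw [Matrix.mem_orthogonalGroup_iff']
    ext i j
    have h := orthonormal_iff_ite.mp b.orthonormal i j
    rw [PiLp.inner_apply] at h
    simp only [Matrix.mul_apply, Matrix.one_apply, ← h]
    simp [mul_comm]
  refine ⟨Matrix.of fun k i => u i k,
    Matrix.of fun i j => if (i : ℕ) = (j : ℕ) then σ j else 0,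
    Matrix.of fun k i => v i k, horth u, horth v, ?_, ?_, ?_⟩
  · intro i j h
    simp [h]
  · intro i j
    simp only [Matrix.of_apply]
    split_ifs
    · exact hσ0 j
    · exact le_rfl
  · have hV := (Matrix.mem_orthogonalGroup_iff (Fin d) ℝ).mp (horth v)
    have key : A * (Matrix.of fun k i => v i k : Matrix (Fin d) (Fin d) ℝ) =
        (Matrix.of fun k i => u i k : Matrix (Fin n) (Fin n) ℝ) *
          Matrix.of fun (i : Fin n) (j : Fin d) => if (i : ℕ) = (j : ℕ) then σ j else 0 := by
      ext k j
      have hl : (A * (Matrix.of fun k i => v i k : Matrix (Fin d) (Fin d) ℝ)) k j = T (v j) k := by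
        simp [T, Matrix.mul_apply, Matrix.toLpLin_apply, Matrix.mulVec, dotProduct]
      rw [hl, Matrix.mul_apply]
      by_cases h : (j : ℕ) < n
      · rw [hTv j h, Finset.sum_eq_single ⟨j, h⟩]
        · simp [mul_comm]
        · intro i _ hi
          have : (i : ℕ) ≠ j := fun h' => hi (Fin.ext h')
          simp [this]
        · simp
      · have h0 : σ j = 0 := by
          by_contra hne
          exact h (hlt j ((hσ0 j).lt_of_ne' hne))
        rw [hker j h0]
        simp [h0]
    rw [← key, Matrix.mul_assoc, hV, Matrix.mul_one]

/-- The number of rows of the Gaussian matrix, `8 ln(2/ν) / η²` rounded up to an integer. -/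
noncomputable def numRows (η ν : ℝ) : ℕ := ⌈8 * Real.log (2 / ν) / η ^ 2⌉₊

/-- The amount `w = (16 √(r ln(2/δ)) / ε) ln(16 r / δ)` by which the spectrum is shifted. -/
noncomputable def shiftParam (r : ℕ) (ε δ : ℝ) : ℝ :=
  16 * Real.sqrt (r * Real.log (2 / δ)) / ε * Real.log (16 * r / δ)

/-- `A - (1/n) 𝟙 𝟙ᵀ A`: subtract from every row the mean of the rows. -/
noncomputable def centerRows {n d : ℕ} (A : Matrix (Fin n) (Fin d) ℝ) :
    Matrix (Fin n) (Fin d) ℝ :=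
  A - (1 / (n : ℝ)) • (Matrix.of (fun _ _ => 1 : Fin n → Fin n → ℝ) * A)

/-- `√(S² + w² I)` for a rectangular diagonal matrix `S`: each entry `σ` of the main diagonal
becomes `√(σ² + w²)`, the entries off the main diagonal are zero. -/
noncomputable def shiftDiag {n d : ℕ} (w : ℝ) (S : Matrix (Fin n) (Fin d) ℝ) :
    Matrix (Fin n) (Fin d) ℝ :=
  Matrix.of fun i j => if (i : ℕ) = (j : ℕ) then Real.sqrt (S i j ^ 2 + w ^ 2) else 0

/-- The law of an `r × n` matrix with independent standard normal entries. -/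
noncomputable def gaussianMatrix (r n : ℕ) : Measure (Matrix (Fin r) (Fin n) ℝ) :=
  (Measure.pi fun _ : Fin r => Measure.pi fun _ : Fin n => gaussianReal 0 1).map Matrix.of

/-- `(1/r) Bᵀ Mᵀ M B`. -/
noncomputable def sketchCovariance {r n d : ℕ} (B : Matrix (Fin n) (Fin d) ℝ)
    (M : Matrix (Fin r) (Fin n) ℝ) : Matrix (Fin d) (Fin d) ℝ :=
  (1 / (r : ℝ)) • (Bᵀ * Mᵀ * M * B)

/-- The law of the output of the algorithm on the input `A`, where `U`, `S`, `V` is the routine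
that computes singular value decompositions: center the rows of `A`, decompose the result,
shift its singular values by `w`, and publish `(1/r) Bᵀ Mᵀ M B` for the resulting matrix `B` and
a Gaussian matrix `M`. -/
noncomputable def sanitizedCovariance {n d : ℕ}
    (U : Matrix (Fin n) (Fin d) ℝ → Matrix (Fin n) (Fin n) ℝ)
    (S : Matrix (Fin n) (Fin d) ℝ → Matrix (Fin n) (Fin d) ℝ)
    (V : Matrix (Fin n) (Fin d) ℝ → Matrix (Fin d) (Fin d) ℝ)
    (ε δ η ν : ℝ) (A : Matrix (Fin n) (Fin d) ℝ) : Measure (Matrix (Fin d) (Fin d) ℝ) :=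
  let r := numRows η ν
  let w := shiftParam r ε δ
  let C := centerRows A
  let B := U C * shiftDiag w (S C) * (V C)ᵀ
  (gaussianMatrix r n).map (sketchCovariance B)

theorem measurable_sketchCovariance {r n d : ℕ} (B : Matrix (Fin n) (Fin d) ℝ) :
    Measurable (sketchCovariance B : Matrix (Fin r) (Fin n) ℝ → Matrix (Fin d) (Fin d) ℝ) := by
  have hM : ∀ (i : Fin r) (j : Fin n),
      Measurable fun M : Matrix (Fin r) (Fin n) ℝ => M i j := fun i j =>
    (measurable_pi_apply j).comp (measurable_pi_apply (X := fun _ : Fin r => Fin n → ℝ) i)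
  refine measurable_pi_lambda _ fun i => measurable_pi_lambda _ fun j => ?_
  simp only [sketchCovariance, Matrix.smul_apply, Matrix.mul_apply, Matrix.transpose_apply]
  fun_prop

instance isProbabilityMeasure_gaussianMatrix (r n : ℕ) :
    IsProbabilityMeasure (gaussianMatrix r n) :=
  Measure.isProbabilityMeasure_map (f := Matrix.of)
    (measurable_id (α := Fin r → Fin n → ℝ)).aemeasurable

instance isProbabilityMeasure_sanitizedCovariance {n d : ℕ}
    (U : Matrix (Fin n) (Fin d) ℝ → Matrix (Fin n) (Fin n) ℝ)
    (S : Matrix (Fin n) (Fin d) ℝ → Matrix (Fin n) (Fin d) ℝ)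
    (V : Matrix (Fin n) (Fin d) ℝ → Matrix (Fin d) (Fin d) ℝ)
    (ε δ η ν : ℝ) (A : Matrix (Fin n) (Fin d) ℝ) :
    IsProbabilityMeasure (sanitizedCovariance U S V ε δ η ν A) :=
  Measure.isProbabilityMeasure_map (measurable_sketchCovariance _).aemeasurable

/-! The rows of `M * B` are independent centred Gaussian vectors with covariance `Bᵀ * B`. This
equals `Cᵀ * C + w² I` for the centred input `C`, whichever decomposition was chosen. Neighboring
inputs give `C = C' + u vᵀ` with `u`, `v` of norm at most one. A single congruence `P` turns the
covariance for `C'` into the identity and that for `C` into `diagonal l`. Both outputs are then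
images, under the same map, of `r` Gaussian samples with independent coordinates, of variances `1`
and `l j` respectively.

The shift by `w²` forces `∑ |l j - 1| ≤ τ = 2 / w + 1 / w ^ 2`. In the logarithm of the `t`-th
moment of a one-dimensional likelihood ratio the terms linear in `l j - 1` cancel, so the whole
moment is at most `exp (r (t + t²) τ²)`, independently of `d`. With `t = ln(2/δ) / ε`, Markov's
inequality needs this to be at most `exp (t ε) δ = 2`, which the choice of `w` ensures. -/

open scoped ENNReal NNReal

/-! ### Density moments of product measures, and privacy -/

/-- The integral of a product of functions of separate coordinates is the product of the
integrals. -/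
theorem lintegral_pi_prod_eq_prod_lintegral {ι : Type*} [Fintype ι] {α : ι → Type*}
    [∀ i, MeasurableSpace (α i)] (μ : ∀ i, Measure (α i)) [∀ i, IsProbabilityMeasure (μ i)]
    {f : ∀ i, α i → ℝ≥0∞} (hf : ∀ i, Measurable (f i)) :
    ∫⁻ x, ∏ i, f i (x i) ∂Measure.pi μ = ∏ i, ∫⁻ x, f i x ∂μ i := by
  have h := lintegral_prod_eq_prod_lintegral_of_indepFun (μ := Measure.pi μ) Finset.univ
    (fun i (x : ∀ i, α i) => f i (x i)) (iIndepFun_pi fun i => (hf i).aemeasurable)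
    (fun i => (hf i).comp (measurable_pi_apply i))
  rw [h]
  refine Finset.prod_congr rfl fun i _ => ?_
  exact (measurePreserving_eval μ i).lintegral_comp (hf i)

/-- A product of measures with densities has the product density. -/
theorem MeasureTheory.Measure.pi_withDensity {ι : Type*} [Fintype ι] {α : ι → Type*}
    [∀ i, MeasurableSpace (α i)] (ν : ∀ i, Measure (α i)) [∀ i, IsProbabilityMeasure (ν i)]
    {f : ∀ i, α i → ℝ≥0∞} (hf : ∀ i, Measurable (f i))
    [∀ i, SigmaFinite ((ν i).withDensity (f i))] :
    Measure.pi (fun i => (ν i).withDensity (f i)) =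
      (Measure.pi ν).withDensity fun x => ∏ i, f i (x i) := by
  classical
  refine Measure.pi_eq fun s hs => ?_
  rw [withDensity_apply _ (MeasurableSet.univ_pi hs),
    ← lintegral_indicator (MeasurableSet.univ_pi hs)]
  have h : (Set.univ.pi s).indicator (fun x : ∀ i, α i => ∏ i, f i (x i)) =
      fun x => ∏ i, (s i).indicator (f i) (x i) := by
    ext x
    by_cases hx : x ∈ Set.univ.pi s
    · rw [Set.indicator_of_mem hx]
      exact Finset.prod_congr rfl fun i _ => (Set.indicator_of_mem (hx i trivial) _).symm
    · rw [Set.indicator_of_notMem hx]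
      simp only [Set.mem_pi, Set.mem_univ, forall_const, not_forall] at hx
      obtain ⟨i, hi⟩ := hx
      exact (Finset.prod_eq_zero (Finset.mem_univ i) (Set.indicator_of_notMem hi _)).symm
  rw [h, lintegral_pi_prod_eq_prod_lintegral ν fun i => (hf i).indicator (hs i)]
  refine Finset.prod_congr rfl fun i _ => ?_
  rw [withDensity_apply _ (hs i), lintegral_indicator (hs i)]

/-- `μ` has a density with respect to `ν` whose `t`-th moment under `μ` is at most `c`; this
bounds the Rényi divergence of order `1 + t` of `μ` from `ν`. -/
def DensityMomentLE {X : Type*} [MeasurableSpace X] (t : ℝ) (μ ν : Measure X) (c : ℝ≥0∞) : Prop :=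
  ∃ f : X → ℝ≥0∞, Measurable f ∧ μ = ν.withDensity f ∧ ∫⁻ x, f x ^ t ∂μ ≤ c

theorem DensityMomentLE.mono {X : Type*} [MeasurableSpace X] {t : ℝ} {μ ν : Measure X}
    {c c' : ℝ≥0∞} (h : DensityMomentLE t μ ν c) (hc : c ≤ c') : DensityMomentLE t μ ν c' := by
  obtain ⟨f, hf, hμ, hm⟩ := h
  exact ⟨f, hf, hμ, hm.trans hc⟩

/-- Density and moment integral both factor over independent coordinates, so Rényi bounds multiply.
-/
theorem DensityMomentLE.pi {ι : Type*} [Fintype ι] {α : ι → Type*}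
    [∀ i, MeasurableSpace (α i)] {μ ν : ∀ i, Measure (α i)} [∀ i, IsProbabilityMeasure (μ i)]
    [∀ i, IsProbabilityMeasure (ν i)] {t : ℝ} (ht : 0 ≤ t) {c : ι → ℝ≥0∞}
    (h : ∀ i, DensityMomentLE t (μ i) (ν i) (c i)) :
    DensityMomentLE t (Measure.pi μ) (Measure.pi ν) (∏ i, c i) := by
  choose f hf hμ hm using h
  refine ⟨fun x => ∏ i, f i (x i), ?_, ?_, ?_⟩
  · exact Finset.measurable_prod _ fun i _ => (hf i).comp (measurable_pi_apply i)
  · have : ∀ i, SigmaFinite ((ν i).withDensity (f i)) := fun i => by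
      rw [← hμ i]; infer_instance
    rw [← Measure.pi_withDensity ν hf]
    congr 1
    exact funext hμ
  · simp only [← ENNReal.prod_rpow_of_nonneg ht]
    rw [lintegral_pi_prod_eq_prod_lintegral μ fun i => (hf i).pow_const t]
    exact Finset.prod_le_prod' fun i _ => hm i

/-- A bound on a moment of the density gives the differential privacy inequality, by Markov's
inequality. -/
theorem DensityMomentLE.measure_le {X : Type*} [MeasurableSpace X] {t : ℝ} {μ ν : Measure X}
    (ht : 0 < t) {ε δ : ℝ}
    (h : DensityMomentLE t μ ν (ENNReal.ofReal (Real.exp (t * ε) * δ))) {S : Set X}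
    (hS : MeasurableSet S) :
    μ S ≤ ENNReal.ofReal (Real.exp ε) * ν S + ENNReal.ofReal δ := by
  obtain ⟨f, hf, hμ, hm⟩ := h
  set e := ENNReal.ofReal (Real.exp ε) with he
  have het : e ^ t = ENNReal.ofReal (Real.exp (t * ε)) := by
    rw [he, ENNReal.ofReal_rpow_of_pos (Real.exp_pos _), ← Real.exp_mul, mul_comm]
  have hT : MeasurableSet {x | e ≤ f x} := measurableSet_le measurable_const hf
  -- Where the density is below `e`, `μ` is at most `e * ν`; Markov's inequality for `f ^ t` bounds
  -- the mass of the rest by `δ`.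
  have h1 : μ (S \ {x | e ≤ f x}) ≤ e * ν S := by
    rw [hμ, withDensity_apply _ (hS.diff hT)]
    calc ∫⁻ x in S \ {x | e ≤ f x}, f x ∂ν ≤ ∫⁻ _ in S \ {x | e ≤ f x}, e ∂ν :=
          setLIntegral_mono measurable_const fun x hx => (not_le.mp hx.2).le
      _ = e * ν (S \ {x | e ≤ f x}) := setLIntegral_const _ _
      _ ≤ e * ν S := by gcongr; exact Set.sdiff_subset
  have h2 : μ {x | e ≤ f x} ≤ ENNReal.ofReal δ := by
    have h3 : e ^ t * μ {x | e ≤ f x} ≤ e ^ t * ENNReal.ofReal δ := by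
      calc e ^ t * μ {x | e ≤ f x} ≤ e ^ t * μ {x | e ^ t ≤ f x ^ t} := by
            exact mul_le_mul' le_rfl (measure_mono fun x hx => ENNReal.rpow_le_rpow hx ht.le)
        _ ≤ ∫⁻ x, f x ^ t ∂μ := mul_meas_ge_le_lintegral (hf.pow_const t) _
        _ ≤ _ := hm
        _ = _ := by rw [het, ENNReal.ofReal_mul (Real.exp_pos _).le]
    rwa [ENNReal.mul_le_mul_iff_right] at h3
    · rw [het]; simp [Real.exp_pos]
    · rw [het]; exact ENNReal.ofReal_ne_top
  calc μ S ≤ μ (S \ {x | e ≤ f x} ∪ {x | e ≤ f x}) := measure_mono (by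
        rw [Set.sdiff_union_self]; exact Set.subset_union_left)
    _ ≤ _ := (measure_union_le _ _).trans (add_le_add h1 h2)

/-! ### Moments of one-dimensional Gaussian likelihood ratios -/

theorem densityMomentLE_gaussianReal {v : ℝ≥0} (hv : v ≠ 0) {t : ℝ}
    (htv : 0 < 1 + t - t * v) :
    DensityMomentLE t (gaussianReal 0 v) (gaussianReal 0 1)
      (ENNReal.ofReal (Real.exp (-(t / 2) * Real.log v - Real.log (1 + t - t * v) / 2))) := by
  have hv0 : (0 : ℝ) < v := by positivity
  have hlog : ∀ y : ℝ, 0 < y → (√y)⁻¹ = Real.exp (-(Real.log y / 2)) := fun y hy => by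
    rw [Real.exp_neg, ← Real.log_sqrt hy.le, Real.exp_log (Real.sqrt_pos.mpr hy)]
  -- The ratio of the two Gaussian densities, with the factor `1 / √v` moved into the exponent.
  let g : ℝ → ℝ := fun x => Real.exp (-(Real.log v / 2) + x ^ 2 / 2 * (1 - 1 / v))
  refine ⟨fun x => ENNReal.ofReal (g x), by fun_prop, ?_, ?_⟩
  · rw [gaussianReal_of_var_ne_zero _ hv, gaussianReal_of_var_ne_zero _ one_ne_zero,
      ← withDensity_mul _ (measurable_gaussianPDF 0 1) (by fun_prop)]
    congr 1
    ext x
    rw [Pi.mul_apply, gaussianPDF, gaussianPDF,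
      ← ENNReal.ofReal_mul (gaussianPDFReal_nonneg _ _ _)]
    congr 1
    simp only [gaussianPDFReal, g, NNReal.coe_one, mul_one]
    rw [Real.sqrt_mul (by positivity) (v : ℝ), mul_inv, hlog v hv0, mul_assoc, mul_assoc,
      ← Real.exp_add, ← Real.exp_add]
    congr 2
    field_simp
    ring
  -- Weighting the density of variance `v` by `g ^ t` gives an unnormalized Gaussian of variance
  -- `v'`; the moment is the ratio of normalizations.
  · let v' : ℝ≥0 := ⟨v / (1 + t - t * v), by positivity⟩
    have hv' : (v' : ℝ) = v / (1 + t - t * v) := rfl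
    have hv'0 : v' ≠ 0 := by
      rw [← NNReal.coe_ne_zero, hv']; positivity
    have hk : ∀ x, ENNReal.ofReal (gaussianPDFReal 0 v x) * ENNReal.ofReal (g x) ^ t =
        ENNReal.ofReal (Real.exp (-(t / 2) * Real.log v - Real.log (1 + t - t * v) / 2)) *
          ENNReal.ofReal (gaussianPDFReal 0 v' x) := fun x => by
      rw [ENNReal.ofReal_rpow_of_pos (Real.exp_pos _),
        ← ENNReal.ofReal_mul (gaussianPDFReal_nonneg _ _ _),
        ← ENNReal.ofReal_mul (Real.exp_pos _).le]
      congr 1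
      simp only [gaussianPDFReal]
      have h1 : 0 < (2 * Real.pi * (v' : ℝ)) := by positivity
      rw [hlog _ h1, hlog _ (by positivity), ← Real.exp_mul, ← Real.exp_add, ← Real.exp_add,
        ← Real.exp_add, ← Real.exp_add, hv', ← mul_div_assoc, Real.log_div (by positivity) htv.ne']
      congr 1
      field_simp
      ring
    rw [gaussianReal_of_var_ne_zero _ hv, lintegral_withDensity_eq_lintegral_mul _
      (measurable_gaussianPDF 0 v) (by fun_prop)]
    simp only [Pi.mul_apply, gaussianPDF, hk]
    rw [lintegral_const_mul _ (by fun_prop), lintegral_gaussianPDFReal_eq_one _ hv'0, mul_one]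

/-- The first-order remainder of the logarithm is at most `x² / (1 - |x|)`, hence at most `2 x²` in
this range. -/
theorem sub_two_mul_sq_le_log_one_add {x : ℝ} (hx : |x| ≤ 1 / 2) :
    x - 2 * x ^ 2 ≤ Real.log (1 + x) := by
  have h1 := Real.abs_log_sub_add_sum_range_le (x := -x) (by rw [abs_neg]; linarith) 1
  simp only [Finset.range_one, Finset.sum_singleton, abs_neg, sub_neg_eq_add] at h1
  have h2 := (abs_le.mp h1).1
  have h3 : |x| ^ (1 + 1) / (1 - |x|) ≤ 2 * x ^ 2 := by
    rw [div_le_iff₀ (by linarith)]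
    norm_num
    nlinarith [sq_nonneg x]
  norm_num at h2 h3
  linarith

/-- With `x = v - 1`, the logarithm of the moment is `-(t/2) log (1 + x) - (1/2) log (1 - t x)`. Its
linear terms cancel and a quadratic error remains. -/
theorem densityMomentLE_gaussianReal_of_abs_le {v : ℝ≥0} {t : ℝ} (ht : 0 ≤ t)
    (h1 : |(v : ℝ) - 1| ≤ 1 / 2) (h2 : |t * ((v : ℝ) - 1)| ≤ 1 / 2) :
    DensityMomentLE t (gaussianReal 0 v) (gaussianReal 0 1)
      (ENNReal.ofReal (Real.exp ((t + t ^ 2) * ((v : ℝ) - 1) ^ 2))) := by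
  have hv : v ≠ 0 := by
    rintro rfl
    norm_num at h1
  have htv : 0 < 1 + t - t * (v : ℝ) := by nlinarith [(abs_le.mp h2).2]
  refine (densityMomentLE_gaussianReal hv htv).mono (ENNReal.ofReal_le_ofReal
    (Real.exp_le_exp.mpr ?_))
  have h3 := sub_two_mul_sq_le_log_one_add h1
  have h4 := sub_two_mul_sq_le_log_one_add (x := -(t * ((v : ℝ) - 1))) (by rwa [abs_neg])
  rw [show 1 + -(t * ((v : ℝ) - 1)) = 1 + t - t * v by ring] at h4
  rw [add_sub_cancel] at h3
  nlinarith [mul_le_mul_of_nonneg_left h3 ht]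

/-! ### The law of the sketch as a function of the covariance -/

theorem charFunDual_gaussianReal_zero_one (L : StrongDual ℝ ℝ) :
    charFunDual (gaussianReal 0 1) L = Complex.exp (-(L 1 : ℂ) ^ 2 / 2) := by
  have h : (L : ℝ → ℝ) = fun x => L 1 * x := by
    ext x
    rw [mul_comm, ← smul_eq_mul, ← map_smul, smul_eq_mul, mul_one]
  rw [charFunDual_eq_charFun_map_one, h, gaussianReal_map_const_mul, charFun_gaussianReal]
  congr 1
  simp
  ring

/-- The law of a linear image `m ᵥ* B` of a standard Gaussian vector `m` depends only on the
covariance matrix `Bᵀ * B`. -/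
theorem map_vecMul_gaussian_eq_of_covariance_eq {n m d : ℕ} {B : Matrix (Fin n) (Fin d) ℝ}
    {B' : Matrix (Fin m) (Fin d) ℝ} (h : Bᵀ * B = B'ᵀ * B') :
    (Measure.pi fun _ : Fin n => gaussianReal 0 1).map (fun x => x ᵥ* B) =
      (Measure.pi fun _ : Fin m => gaussianReal 0 1).map (fun x => x ᵥ* B') := by
  -- Characteristic functions determine the law. Here they factor over the coordinates, and the
  -- exponents add up to a quadratic form in `Cᵀ * C`.
  have key : ∀ {k : ℕ} (C : Matrix (Fin k) (Fin d) ℝ) (L : StrongDual ℝ (Fin d → ℝ)),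
      charFunDual ((Measure.pi fun _ : Fin k => gaussianReal 0 1).map (fun x => x ᵥ* C)) L =
        Complex.exp (((-(∑ i, ∑ j, L (Pi.single i 1) * L (Pi.single j 1) * (Cᵀ * C) i j) / 2 : ℝ)
          : ℂ)) := by
    intro k C L
    let T : (Fin k → ℝ) →L[ℝ] (Fin d → ℝ) := LinearMap.toContinuousLinearMap (Matrix.vecMulLinear C)
    have hT : (fun x : Fin k → ℝ => x ᵥ* C) = T := rfl
    rw [hT, charFunDual_map, charFunDual_pi]
    simp only [charFunDual_gaussianReal_zero_one]
    rw [← Complex.exp_sum]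
    congr 1
    have hL : ∀ y : Fin d → ℝ, L y = ∑ j, y j * L (Pi.single j 1) := fun y => by
      conv_lhs => rw [← Finset.univ_sum_single y, map_sum]
      refine Finset.sum_congr rfl fun j _ => ?_
      rw [← smul_eq_mul, ← map_smul, ← Pi.single_smul, smul_eq_mul, mul_one]
    have hTi : ∀ i, ((L.comp T).comp (.single ℝ (fun _ : Fin k => ℝ) i)) 1 =
        ∑ j, C i j * L (Pi.single j 1) := fun i => by
      change L (Pi.single i 1 ᵥ* C) = _
      rw [hL, Matrix.single_one_vecMul]
      rfl
    simp only [hTi]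
    rw [← Finset.sum_div, Finset.sum_neg_distrib]
    norm_cast
    rw [neg_inj.mpr]
    simp only [Matrix.mul_apply, Matrix.transpose_apply, Finset.mul_sum, sq, Finset.sum_mul]
    rw [Finset.sum_comm]
    refine Finset.sum_congr rfl fun i _ => ?_
    rw [Finset.sum_comm]
    refine Finset.sum_congr rfl fun j _ => Finset.sum_congr rfl fun l _ => ?_
    ring
  have : IsProbabilityMeasure
      ((Measure.pi fun _ : Fin n => gaussianReal 0 1).map (fun x => x ᵥ* B)) :=
    Measure.isProbabilityMeasure_map (by fun_prop)
  have : IsProbabilityMeasure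
      ((Measure.pi fun _ : Fin m => gaussianReal 0 1).map (fun x => x ᵥ* B')) :=
    Measure.isProbabilityMeasure_map (by fun_prop)
  refine Measure.ext_of_charFunDual ?_
  ext L
  rw [key B, key B', h]

theorem measurable_matrix_of (r d : ℕ) :
    Measurable (Matrix.of : (Fin r → Fin d → ℝ) → Matrix (Fin r) (Fin d) ℝ) :=
  measurable_id (α := Fin r → Fin d → ℝ)

/-- Since `M (B P) = (M B) P`, the factor `B` affects only the law of the independent rows, while
`P` is mere post-processing. -/
theorem map_sketchCovariance_eq {r n d e : ℕ} (B : Matrix (Fin n) (Fin d) ℝ)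
    (P : Matrix (Fin d) (Fin e) ℝ) :
    (gaussianMatrix r n).map (sketchCovariance (B * P)) =
      (Measure.pi fun _ : Fin r =>
        (Measure.pi fun _ : Fin n => gaussianReal 0 1).map (fun x => x ᵥ* B)).map
        (fun x => sketchCovariance P (Matrix.of x)) := by
  have h : ∀ _ : Fin r, SigmaFinite
      ((Measure.pi fun _ : Fin n => gaussianReal 0 1).map (fun x => x ᵥ* B)) := fun _ => by
    have := Measure.isProbabilityMeasure_map (μ := Measure.pi fun _ : Fin n => gaussianReal 0 1)
      (f := fun x => x ᵥ* B) (by fun_prop)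
    infer_instance
  rw [← Measure.pi_map_pi (fun _ => by fun_prop), Measure.map_map (g := fun x =>
    sketchCovariance P (Matrix.of x)) ((measurable_sketchCovariance P).comp (measurable_matrix_of r d)) (by fun_prop),
    gaussianMatrix, Measure.map_map (measurable_sketchCovariance _) (measurable_matrix_of r n)]
  congr 1
  ext x : 1
  have hx : Matrix.of (fun i => x i ᵥ* B) = Matrix.of x * B := rfl
  simp only [Function.comp_apply, sketchCovariance, hx, Matrix.transpose_mul, Matrix.mul_assoc]

/-- The law of `sketchCovariance B` on Gaussian matrices depends only on `Bᵀ * B`. -/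
theorem map_sketchCovariance_eq_of_covariance_eq {r n m d : ℕ} {B : Matrix (Fin n) (Fin d) ℝ}
    {B' : Matrix (Fin m) (Fin d) ℝ} (h : Bᵀ * B = B'ᵀ * B') :
    (gaussianMatrix r n).map (sketchCovariance B) =
      (gaussianMatrix r m).map (sketchCovariance B') := by
  rw [← Matrix.mul_one B, ← Matrix.mul_one B', map_sketchCovariance_eq, map_sketchCovariance_eq,
    map_vecMul_gaussian_eq_of_covariance_eq h]

theorem map_sketchCovariance_diagonal_mul {r d e : ℕ} (v : Fin d → ℝ≥0)
    (P : Matrix (Fin d) (Fin e) ℝ) :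
    (gaussianMatrix r d).map
        (sketchCovariance (Matrix.diagonal (fun j => √(v j : ℝ)) * P)) =
      (Measure.pi fun _ : Fin r => Measure.pi fun j => gaussianReal 0 (v j)).map
        (fun x => sketchCovariance P (Matrix.of x)) := by
  have h : ∀ j, (gaussianReal 0 1).map (fun x => x * √(v j : ℝ)) = gaussianReal 0 (v j) := by
    intro j
    rw [gaussianReal_map_mul_const, mul_zero, mul_one]
    congr 1
    ext
    exact Real.sq_sqrt (v j).2
  have h' : ∀ j, SigmaFinite ((gaussianReal 0 1).map (fun x => x * √(v j : ℝ))) := fun j => by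
    rw [h j]; infer_instance
  have h2 : (Measure.pi fun _ : Fin d => gaussianReal 0 1).map
      (fun x => x ᵥ* Matrix.diagonal (fun j => √(v j : ℝ))) =
        Measure.pi fun j => gaussianReal 0 (v j) := by
    simp only [← h]
    rw [← Measure.pi_map_pi (fun _ => by fun_prop)]
    congr 1
    ext x j
    simp [Matrix.vecMul_diagonal]
  rw [map_sketchCovariance_eq, h2]

/-! ### Simultaneous diagonalization and rank one perturbations -/

/-- The spectral theorem for real symmetric matrices, with an orthogonal matrix. -/
theorem exists_orthogonal_diagonalization {d : ℕ} {N : Matrix (Fin d) (Fin d) ℝ}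
    (hN : N.IsHermitian) :
    ∃ O : Matrix (Fin d) (Fin d) ℝ, Oᵀ * O = 1 ∧
      N = Oᵀ * Matrix.diagonal hN.eigenvalues * O := by
  refine ⟨(hN.eigenvectorUnitary : Matrix (Fin d) (Fin d) ℝ)ᵀ, ?_, ?_⟩
  · have h : (hN.eigenvectorUnitary : Matrix (Fin d) (Fin d) ℝ) *
        star (hN.eigenvectorUnitary : Matrix (Fin d) (Fin d) ℝ) = 1 :=
      Unitary.coe_mul_star_self hN.eigenvectorUnitary
    rwa [Matrix.star_eq_conjTranspose, Matrix.conjTranspose_eq_transpose_of_trivial] at h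
  · conv_lhs => rw [hN.spectral_theorem, Unitary.conjStarAlgAut_apply]
    rw [Matrix.star_eq_conjTranspose, Matrix.conjTranspose_eq_transpose_of_trivial,
      Matrix.transpose_transpose]
    rfl

/-- A positive definite and a symmetric matrix are simultaneously congruent to the identity
and to a diagonal matrix. -/
theorem exists_simultaneous_diagonalization {d : ℕ} {M N : Matrix (Fin d) (Fin d) ℝ}
    (hM : M.PosDef) (hN : N.IsHermitian) :
    ∃ (P Q : Matrix (Fin d) (Fin d) ℝ) (l : Fin d → ℝ), P * Q = 1 ∧ Pᵀ * P = M ∧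
      Pᵀ * Matrix.diagonal l * P = N := by
  obtain ⟨O, hO, hMO⟩ := exists_orthogonal_diagonalization hM.isHermitian
  have hO' : O * Oᵀ = 1 := mul_eq_one_comm.mp hO
  set s : Fin d → ℝ := fun i => √(hM.isHermitian.eigenvalues i) with hs
  have hs0 : ∀ i, 0 < s i := fun i => Real.sqrt_pos.mpr (hM.eigenvalues_pos i)
  have hss : Matrix.diagonal s * Matrix.diagonal s =
      Matrix.diagonal hM.isHermitian.eigenvalues := by
    rw [Matrix.diagonal_mul_diagonal]
    congr 1
    ext i
    exact Real.mul_self_sqrt (hM.eigenvalues_pos i).le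
  have hsi : Matrix.diagonal s * Matrix.diagonal (fun i => (s i)⁻¹) = 1 := by
    rw [Matrix.diagonal_mul_diagonal, ← Matrix.diagonal_one]
    congr 1
    ext i
    exact mul_inv_cancel₀ (hs0 i).ne'
  -- `P₀` is a square root of `M`. A further orthogonal factor `R` leaves `P₀ᵀ * P₀` unchanged and
  -- is free to diagonalize `N`.
  set P₀ := Matrix.diagonal s * O with hP₀
  set Q₀ := Oᵀ * Matrix.diagonal (fun i => (s i)⁻¹) with hQ₀
  have hPQ₀ : P₀ * Q₀ = 1 := by
    rw [hP₀, hQ₀, Matrix.mul_assoc, ← Matrix.mul_assoc O, hO', Matrix.one_mul, hsi]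
  have hQP₀ : Q₀ * P₀ = 1 := mul_eq_one_comm.mp hPQ₀
  have hPP₀ : P₀ᵀ * P₀ = M := by
    rw [hMO, hP₀, Matrix.transpose_mul, Matrix.diagonal_transpose, ← hss]
    simp only [Matrix.mul_assoc]
  have hH : (Q₀ᵀ * N * Q₀).IsHermitian := by
    rw [Matrix.IsHermitian, Matrix.conjTranspose_eq_transpose_of_trivial] at hN ⊢
    rw [Matrix.transpose_mul, Matrix.transpose_mul Q₀ᵀ, hN, Matrix.transpose_transpose,
      Matrix.mul_assoc]
  obtain ⟨R, hR, hNR⟩ := exists_orthogonal_diagonalization hH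
  have hR' : R * Rᵀ = 1 := mul_eq_one_comm.mp hR
  refine ⟨R * P₀, Q₀ * Rᵀ, hH.eigenvalues, ?_, ?_, ?_⟩
  · rw [Matrix.mul_assoc, ← Matrix.mul_assoc P₀, hPQ₀, Matrix.one_mul, hR']
  · rw [Matrix.transpose_mul, Matrix.mul_assoc, ← Matrix.mul_assoc Rᵀ, hR, Matrix.one_mul, hPP₀]
  · calc (R * P₀)ᵀ * Matrix.diagonal hH.eigenvalues * (R * P₀)
        = P₀ᵀ * (Rᵀ * Matrix.diagonal hH.eigenvalues * R) * P₀ := by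
          simp only [Matrix.transpose_mul, Matrix.mul_assoc]
      _ = (Q₀ * P₀)ᵀ * N * (Q₀ * P₀) := by
          rw [← hNR]
          simp only [Matrix.transpose_mul, Matrix.mul_assoc]
      _ = N := by rw [hQP₀]; simp

theorem dotProduct_sq_le {n : ℕ} (x y : Fin n → ℝ) :
    (x ⬝ᵥ y) ^ 2 ≤ (x ⬝ᵥ x) * (y ⬝ᵥ y) := by
  have h := Finset.sum_mul_sq_le_sq_mul_sq Finset.univ x y
  simpa only [dotProduct, sq] using h

/-- The transpose of a matrix has the same operator norm bound as the matrix. -/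
theorem vecMul_dotProduct_self_le {n d : ℕ} {K : Matrix (Fin n) (Fin d) ℝ} {c : ℝ} (hc : 0 ≤ c)
    (hK : ∀ x, (K *ᵥ x) ⬝ᵥ (K *ᵥ x) ≤ c * (x ⬝ᵥ x)) {u : Fin n → ℝ} (hu : u ⬝ᵥ u ≤ 1) :
    (u ᵥ* K) ⬝ᵥ (u ᵥ* K) ≤ c := by
  set a := u ᵥ* K with ha
  have h0 : 0 ≤ a ⬝ᵥ a := Finset.sum_nonneg fun i _ => mul_self_nonneg _
  have h1 : a ⬝ᵥ a = u ⬝ᵥ (K *ᵥ a) := by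
    conv_lhs => rw [ha, ← Matrix.dotProduct_mulVec]
  have h2 := dotProduct_sq_le u (K *ᵥ a)
  -- Cauchy–Schwarz on `a ⬝ᵥ a = u ⬝ᵥ (K *ᵥ a)`; one factor `a ⬝ᵥ a` is cancelled below when
  -- nonzero.
  have h3 : (a ⬝ᵥ a) * (a ⬝ᵥ a) ≤ c * (a ⬝ᵥ a) := by
    have h4 : 0 ≤ (K *ᵥ a) ⬝ᵥ (K *ᵥ a) := Finset.sum_nonneg fun i _ => mul_self_nonneg _
    rw [← h1] at h2
    nlinarith [hK a, mul_le_mul_of_nonneg_right hu h4]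
  rcases h0.eq_or_lt with h | h
  · rw [← h]; exact hc
  · exact le_of_mul_le_mul_right h3 h

theorem mulVec_dotProduct_mulVec_self {n d : ℕ} (C : Matrix (Fin n) (Fin d) ℝ) (x : Fin d → ℝ) :
    (C *ᵥ x) ⬝ᵥ (C *ᵥ x) = x ⬝ᵥ ((Cᵀ * C) *ᵥ x) := by
  rw [← Matrix.mulVec_mulVec, Matrix.dotProduct_mulVec x, Matrix.vecMul_transpose]

/-- A rank one perturbation of `C` by a product of vectors of norm at most one changes
`Cᵀ * C + w² I` by relative eigenvalues whose absolute deviations from one sum up to at most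
`2 / w + 1 / w ^ 2`. -/
theorem exists_diagonalization_of_rank_one_perturbation {n d : ℕ}
    {C C' : Matrix (Fin n) (Fin d) ℝ} {u : Fin n → ℝ} {v : Fin d → ℝ} {w : ℝ} (hw : 0 < w)
    (hu : u ⬝ᵥ u ≤ 1) (hv : v ⬝ᵥ v ≤ 1) (hC : C = C' + Matrix.vecMulVec u v) :
    ∃ (P : Matrix (Fin d) (Fin d) ℝ) (l : Fin d → ℝ),
      Pᵀ * P = C'ᵀ * C' + w ^ 2 • (1 : Matrix (Fin d) (Fin d) ℝ) ∧
      Pᵀ * Matrix.diagonal l * P = Cᵀ * C + w ^ 2 • (1 : Matrix (Fin d) (Fin d) ℝ) ∧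
      ∑ j, |l j - 1| ≤ 2 / w + 1 / w ^ 2 := by
  have hpd : (C'ᵀ * C' + w ^ 2 • (1 : Matrix (Fin d) (Fin d) ℝ)).PosDef := by
    have h := Matrix.posSemidef_conjTranspose_mul_self C'
    rw [Matrix.conjTranspose_eq_transpose_of_trivial] at h
    exact Matrix.PosDef.posSemidef_add h (Matrix.PosDef.one.smul (by positivity))
  have hH : (Cᵀ * C + w ^ 2 • (1 : Matrix (Fin d) (Fin d) ℝ)).IsHermitian := by
    rw [Matrix.IsHermitian, Matrix.conjTranspose_eq_transpose_of_trivial]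
    simp
  obtain ⟨P, Q, l, hPQ, hP, hN⟩ := exists_simultaneous_diagonalization hpd hH
  refine ⟨P, l, hP, hN, ?_⟩
  have hquad : ∀ (D : Matrix (Fin n) (Fin d) ℝ) (q : Fin d → ℝ),
      q ⬝ᵥ ((Dᵀ * D + w ^ 2 • (1 : Matrix (Fin d) (Fin d) ℝ)) *ᵥ q) =
        (D *ᵥ q) ⬝ᵥ (D *ᵥ q) + w ^ 2 * (q ⬝ᵥ q) := fun D q => by
    rw [Matrix.add_mulVec, dotProduct_add, ← mulVec_dotProduct_mulVec_self, Matrix.smul_mulVec,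
      Matrix.one_mulVec, dotProduct_smul, smul_eq_mul]
  have hcong : ∀ (D : Matrix (Fin d) (Fin d) ℝ) (x : Fin d → ℝ),
      (Q *ᵥ x) ⬝ᵥ ((Pᵀ * D * P) *ᵥ (Q *ᵥ x)) = x ⬝ᵥ (D *ᵥ x) := fun D x => by
    rw [← Matrix.mulVec_mulVec, ← Matrix.mulVec_mulVec, Matrix.dotProduct_mulVec,
      Matrix.vecMul_transpose, Matrix.mulVec_mulVec x P Q, hPQ, Matrix.one_mulVec]
  -- The map `x ↦ (C' Q x, w Q x)` is an isometry, so `C' Q` has norm at most `1` and `Q` at most `1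
  -- / w`.
  have hI : ∀ x, (C' *ᵥ (Q *ᵥ x)) ⬝ᵥ (C' *ᵥ (Q *ᵥ x)) + w ^ 2 * ((Q *ᵥ x) ⬝ᵥ (Q *ᵥ x)) =
      x ⬝ᵥ x := fun x => by
    rw [← hquad, ← hP, ← Matrix.mul_one Pᵀ, hcong, Matrix.one_mulVec]
  have hnn : ∀ {k : ℕ} (x : Fin k → ℝ), 0 ≤ x ⬝ᵥ x := fun x =>
    Finset.sum_nonneg fun i _ => mul_self_nonneg _
  set a := u ᵥ* (C' * Q) with ha
  set b := v ᵥ* Q with hb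
  have hal : a ⬝ᵥ a ≤ 1 := by
    refine vecMul_dotProduct_self_le zero_le_one (fun x => ?_) hu
    rw [← Matrix.mulVec_mulVec, one_mul, ← hI x]
    exact le_add_of_nonneg_right (mul_nonneg (by positivity) (hnn _))
  have hbl : b ⬝ᵥ b ≤ 1 / w ^ 2 := by
    refine vecMul_dotProduct_self_le (by positivity) (fun x => ?_) hv
    rw [← hI x, one_div, ← div_eq_inv_mul, le_div_iff₀ (by positivity), mul_comm]
    exact le_add_of_nonneg_left (hnn _)
  -- Both quadratic forms are evaluated at `Q e_j`; their difference is the expansion of the rank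
  -- one term.
  have hl : ∀ j, l j - 1 = 2 * (a j * b j) + (u ⬝ᵥ u) * (b j * b j) := fun j => by
    set e : Fin d → ℝ := Pi.single j 1 with he
    have h1 := hcong (Matrix.diagonal l) e
    have h2 := hI e
    rw [hN, hquad, hC, Matrix.add_mulVec, Matrix.vecMulVec_mulVec] at h1
    have h3 : v ⬝ᵥ (Q *ᵥ e) = b j := by
      rw [Matrix.dotProduct_mulVec, he, dotProduct_single_one]
    have h4 : u ⬝ᵥ (C' *ᵥ (Q *ᵥ e)) = a j := by
      rw [Matrix.mulVec_mulVec, Matrix.dotProduct_mulVec, he, dotProduct_single_one]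
    have h5 : e ⬝ᵥ e = 1 := by simp [he]
    have h6 : e ⬝ᵥ (Matrix.diagonal l *ᵥ e) = l j := by simp [he]
    rw [h3, h6] at h1
    rw [h5] at h2
    simp only [add_dotProduct, dotProduct_add, dotProduct_smul, smul_dotProduct,
      MulOpposite.smul_eq_mul_unop, MulOpposite.unop_op, h4,
      dotProduct_comm _ u] at h1
    linarith
  have hj : ∀ j, |l j - 1| ≤ w⁻¹ * (a j * a j) + w * (b j * b j) + b j * b j := fun j => by
    -- The weight `w` balances `‖a‖² ≤ 1` against `‖b‖² ≤ 1 / w²`: after summation each part is at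
    -- most `1 / w`.
    have hab : 2 * |a j * b j| ≤ w⁻¹ * (a j * a j) + w * (b j * b j) := by
      have h1 : w⁻¹ * (a j * a j) + w * (b j * b j) - 2 * |a j * b j| =
          w⁻¹ * (|a j| - w * |b j|) ^ 2 := by
        rw [abs_mul, ← abs_mul_abs_self (a j), ← abs_mul_abs_self (b j)]
        field_simp
        ring
      have h2 : 0 ≤ w⁻¹ * (|a j| - w * |b j|) ^ 2 := by positivity
      linarith
    have hbb : 0 ≤ b j * b j := mul_self_nonneg _
    rw [hl j]
    refine (abs_add_le _ _).trans (add_le_add ?_ ?_)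
    · rwa [abs_mul, abs_two]
    · rw [abs_of_nonneg (mul_nonneg (hnn u) hbb)]
      exact mul_le_of_le_one_left hbb hu
  calc ∑ j, |l j - 1| ≤ ∑ j, (w⁻¹ * (a j * a j) + w * (b j * b j) + b j * b j) :=
        Finset.sum_le_sum fun j _ => hj j
    _ = w⁻¹ * (a ⬝ᵥ a) + w * (b ⬝ᵥ b) + b ⬝ᵥ b := by
        simp only [Finset.sum_add_distrib, ← Finset.mul_sum, dotProduct]
    _ ≤ w⁻¹ * 1 + w * (1 / w ^ 2) + 1 / w ^ 2 := by gcongr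
    _ = 2 / w + 1 / w ^ 2 := by field_simp; norm_num

/-! ### Covariance of the shifted matrix and effect of centering -/

/-- As `d ≤ n`, every column meets the main diagonal, so all `d` diagonal entries of the Gram matrix
gain `w²`. -/
theorem transpose_shiftDiag_mul_shiftDiag {n d : ℕ} (hd : d ≤ n) (w : ℝ)
    {S : Matrix (Fin n) (Fin d) ℝ} (hS : ∀ (i : Fin n) (j : Fin d), (i : ℕ) ≠ j → S i j = 0) :
    (shiftDiag w S)ᵀ * shiftDiag w S = Sᵀ * S + w ^ 2 • (1 : Matrix (Fin d) (Fin d) ℝ) := by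
  ext j k
  have hT : ∀ T : Matrix (Fin n) (Fin d) ℝ,
      (∀ (i : Fin n) (j : Fin d), (i : ℕ) ≠ j → T i j = 0) →
      (Tᵀ * T) j k = T (Fin.castLE hd j) j * T (Fin.castLE hd j) k := fun T hT => by
    rw [Matrix.mul_apply, Finset.sum_eq_single (Fin.castLE hd j)]
    · rfl
    · intro i _ hi
      rw [Matrix.transpose_apply, hT i j fun h => hi (Fin.ext h), zero_mul]
    · simp
  have hs : ∀ (i : Fin n) (j : Fin d), (i : ℕ) ≠ j → shiftDiag w S i j = 0 := fun i j h => by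
    simp [shiftDiag, h]
  rw [Matrix.add_apply, hT _ hs, hT _ hS]
  by_cases hjk : j = k
  · subst hjk
    simp only [shiftDiag, Matrix.of_apply, Fin.val_castLE, if_true, Matrix.smul_apply,
      Matrix.one_apply_eq]
    rw [Real.mul_self_sqrt (by positivity)]
    simp [sq]
  · have h : ((Fin.castLE hd j : Fin n) : ℕ) ≠ k := fun h => hjk (Fin.ext h)
    rw [hs _ k h, hS _ k h]
    simp [hjk]

/-- `U` cancels in the Gram matrix and `V * Vᵀ = 1` keeps the shift scalar; hence the choice of
decomposition is irrelevant. -/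
theorem IsSVD.covariance_shiftDiag {n d : ℕ} (hd : d ≤ n) {C : Matrix (Fin n) (Fin d) ℝ}
    {U : Matrix (Fin n) (Fin n) ℝ} {S : Matrix (Fin n) (Fin d) ℝ} {V : Matrix (Fin d) (Fin d) ℝ}
    (h : IsSVD C U S V) (w : ℝ) :
    (U * shiftDiag w S * Vᵀ)ᵀ * (U * shiftDiag w S * Vᵀ) =
      Cᵀ * C + w ^ 2 • (1 : Matrix (Fin d) (Fin d) ℝ) := by
  have hU : Uᵀ * U = 1 := (Matrix.mem_orthogonalGroup_iff' (Fin n) ℝ).mp h.orthogonal_left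
  have hV : V * Vᵀ = 1 := (Matrix.mem_orthogonalGroup_iff (Fin d) ℝ).mp h.orthogonal_right
  have hX : ∀ X : Matrix (Fin n) (Fin d) ℝ,
      (U * X * Vᵀ)ᵀ * (U * X * Vᵀ) = V * (Xᵀ * X) * Vᵀ := fun X => by
    calc (U * X * Vᵀ)ᵀ * (U * X * Vᵀ) = V * (Xᵀ * (Uᵀ * U) * X) * Vᵀ := by
          simp only [Matrix.transpose_mul, Matrix.transpose_transpose, Matrix.mul_assoc]
      _ = _ := by rw [hU, Matrix.mul_one]
  rw [hX, transpose_shiftDiag_mul_shiftDiag hd w h.off_diag, h.eq, hX, Matrix.mul_add,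
    Matrix.add_mul, Matrix.mul_smul, Matrix.mul_one, Matrix.smul_mul, hV]

/-- Centering turns a change of one row into a rank one perturbation by vectors of norm at most
one. -/
theorem MatrixNeighbors.centerRows_eq_add {n d : ℕ} {A A' : Matrix (Fin n) (Fin d) ℝ}
    (h : MatrixNeighbors A A') :
    ∃ (u : Fin n → ℝ) (v : Fin d → ℝ), u ⬝ᵥ u ≤ 1 ∧ v ⬝ᵥ v ≤ 1 ∧
      centerRows A = centerRows A' + Matrix.vecMulVec u v := by
  obtain ⟨i, hi, hv⟩ := h
  have hn : (0 : ℝ) < n := by exact_mod_cast i.pos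
  set e : Fin n → ℝ := Pi.single i 1 with he
  -- The centred unit vector has squared norm `1 - 1 / n`.
  refine ⟨e - (1 / (n : ℝ)) • 1, A i - A' i, ?_, ?_, ?_⟩
  · have h1 : e ⬝ᵥ e = 1 := by simp [he]
    have h2 : e ⬝ᵥ 1 = 1 := by simp [he]
    have h3 : (1 : Fin n → ℝ) ⬝ᵥ e = 1 := by rw [dotProduct_comm, h2]
    have h4 : (1 : Fin n → ℝ) ⬝ᵥ 1 = n := by simp
    simp only [sub_dotProduct, dotProduct_sub, smul_dotProduct, dotProduct_smul, h1, h2, h3, h4,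
      smul_eq_mul]
    have h5 : 0 < 1 / (n : ℝ) := by positivity
    have h6 : 1 / (n : ℝ) * n = 1 := by field_simp
    nlinarith
  · have h1 : ‖WithLp.toLp 2 (A i - A' i)‖ ^ 2 ≤ 1 := pow_le_one₀ (norm_nonneg _) hv
    rw [EuclideanSpace.real_norm_sq_eq] at h1
    simpa only [dotProduct, ← sq] using h1
  · have hA : A = A' + Matrix.vecMulVec e (A i - A' i) := by
      ext j k
      by_cases hj : j = i
      · subst hj
        simp [Matrix.vecMulVec_apply, he]
      · simp [Matrix.vecMulVec_apply, he, hj, hi j hj]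
    have hJ : (Matrix.of (fun _ _ => 1 : Fin n → Fin n → ℝ)) *ᵥ e = 1 := by
      ext j
      simp [he]
    unfold centerRows
    conv_lhs => rw [hA]
    rw [Matrix.mul_add, Matrix.mul_vecMulVec, hJ, Matrix.sub_vecMulVec, Matrix.smul_vecMulVec,
      smul_add]
    abel

/-! ### Choice of constants and conclusion -/

/-- The shift parameter is large enough for the moment bound of order `ln(2/δ) / ε`. -/
theorem shiftParam_bounds {r : ℕ} (hr : 0 < r) {ε δ : ℝ} (hε : 0 < ε) (hδ : 0 < δ) (hδ1 : δ < 1)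
    (hεδ : ε ≤ max 1 (Real.log (2 / δ))) {w t τ : ℝ} (hw : w = shiftParam r ε δ)
    (ht : t = Real.log (2 / δ) / ε) (hτ : τ = 2 / w + 1 / w ^ 2) :
    0 < w ∧ 0 < t ∧ τ ≤ 1 / 2 ∧ t * τ ≤ 1 / 2 ∧ r * (t + t ^ 2) * τ ^ 2 ≤ Real.log 2 := by
  have hr1 : (1 : ℝ) ≤ r := by exact_mod_cast hr
  have hlog2 := Real.log_two_gt_d9
  rw [shiftParam] at hw
  have hL : 0.69 ≤ Real.log (2 / δ) := by
    have : Real.log 2 ≤ Real.log (2 / δ) := Real.log_le_log two_pos (by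
      rw [le_div_iff₀ hδ]; linarith)
    linarith
  -- Uses `16 r / δ ≥ 8 · (2 / δ)` and `3 ln 2 > 2`.
  have hl : Real.log (2 / δ) + 2 ≤ Real.log (16 * r / δ) := by
    have h1 : Real.log (2 / δ * 2 ^ 3) ≤ Real.log (16 * r / δ) := by
      refine Real.log_le_log (by positivity) ?_
      rw [div_mul_eq_mul_div]
      refine div_le_div_of_nonneg_right ?_ hδ.le
      linarith
    rw [Real.log_mul (by positivity) (by norm_num), Real.log_pow] at h1
    push_cast at h1
    linarith
  set L := Real.log (2 / δ)
  set l := Real.log (16 * r / δ)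
  have hεl : ε ≤ l := hεδ.trans (max_le (by linarith) (by linarith))
  have hss : √(r * L) ^ 2 = r * L := Real.sq_sqrt (by positivity)
  have hs : 0.8 ≤ √(r * L) := Real.le_sqrt_of_sq_le (by nlinarith)
  set s := √(r * L)
  have hl0 : 0 < l := by linarith
  have hL0 : 0 < L := by linarith
  have hs0 : 0 < s := by linarith
  have hr0 : (0 : ℝ) < r := by linarith
  have hw0 : 0 < w := by rw [hw]; positivity
  have ht0 : 0 < t := by rw [ht]; positivity
  have hw12 : 12 ≤ w := by
    have : 16 * s ≤ w := by
      rw [hw, div_mul_eq_mul_div, le_div_iff₀ hε]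
      exact mul_le_mul_of_nonneg_left hεl (by positivity)
    linarith
  have hτ0 : 0 ≤ τ := by rw [hτ]; positivity
  have hτw : τ ≤ 3 / w := by
    have : 1 / w ^ 2 ≤ 1 / w := one_div_le_one_div_of_le hw0 (by nlinarith)
    calc τ ≤ 2 / w + 1 / w := by rw [hτ]; gcongr
      _ = 3 / w := by ring
  refine ⟨hw0, ht0, hτw.trans ?_, ?_, ?_⟩
  · rw [div_le_iff₀ hw0]
    linarith
  · calc t * τ ≤ t * (3 / w) := by gcongr
      _ = 3 * L / (16 * s * l) := by rw [ht, hw]; field_simp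
      _ ≤ 1 / 2 := by
        rw [div_le_iff₀ (by positivity)]
        nlinarith
  -- The factor `√(r L)` in `w` cancels `r L`; then `ε` and `L` are both at most `l`.
  · calc r * (t + t ^ 2) * τ ^ 2 ≤ r * (t + t ^ 2) * (3 / w) ^ 2 := by gcongr
      _ = 9 * (r * L) * (ε + L) / (256 * s ^ 2 * l ^ 2) := by
        rw [ht, hw]; field_simp; ring
      _ = 9 * (ε + L) / (256 * l ^ 2) := by rw [hss]; field_simp
      _ ≤ 1 / 2 := by
        rw [div_le_iff₀ (by positivity)]
        nlinarith
      _ ≤ Real.log 2 := by linarith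

/-- Samples of Gaussian vectors with independent coordinates of variances close to one are
indistinguishable from standard Gaussian samples. -/
theorem densityMomentLE_pi_gaussianReal {r d : ℕ} {l : Fin d → ℝ} {t τ : ℝ} (ht : 0 ≤ t)
    (hl : ∑ j, |l j - 1| ≤ τ) (hτ : τ ≤ 1 / 2) (htτ : t * τ ≤ 1 / 2) :
    DensityMomentLE t
      (Measure.pi fun _ : Fin r => Measure.pi fun j => gaussianReal 0 (l j).toNNReal)
      (Measure.pi fun _ : Fin r => Measure.pi fun _ : Fin d => gaussianReal 0 1)
      (ENNReal.ofReal (Real.exp (r * (t + t ^ 2) * τ ^ 2))) := by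
  have hj : ∀ j, |l j - 1| ≤ τ := fun j =>
    (Finset.single_le_sum (f := fun j => |l j - 1|) (fun _ _ => abs_nonneg _)
      (Finset.mem_univ j)).trans hl
  have hcoe : ∀ j, ((l j).toNNReal : ℝ) = l j := fun j => by
    have := (abs_le.mp ((hj j).trans hτ)).1
    exact Real.coe_toNNReal _ (by linarith)
  have h1 : ∀ j, DensityMomentLE t (gaussianReal 0 (l j).toNNReal) (gaussianReal 0 1)
      (ENNReal.ofReal (Real.exp ((t + t ^ 2) * (l j - 1) ^ 2))) := fun j => by
    have h := densityMomentLE_gaussianReal_of_abs_le (v := (l j).toNNReal) ht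
    rw [hcoe] at h
    refine h ((hj j).trans hτ) ?_
    rw [abs_mul, abs_of_nonneg ht]
    exact (mul_le_mul_of_nonneg_left (hj j) ht).trans htτ
  refine (DensityMomentLE.pi ht fun _ : Fin r => DensityMomentLE.pi ht h1).mono ?_
  rw [Finset.prod_const, Finset.card_univ, Fintype.card_fin,
    ← ENNReal.ofReal_prod_of_nonneg fun _ _ => (Real.exp_pos _).le, ← Real.exp_sum,
    ← ENNReal.ofReal_pow (Real.exp_pos _).le, ← Real.exp_nat_mul, ← Finset.mul_sum, mul_assoc]
  -- Bounding the squares by the square of the `ℓ¹` norm keeps the dimension out of the estimate.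
  have h2 : ∑ j, (l j - 1) ^ 2 ≤ τ ^ 2 := by
    calc ∑ j, (l j - 1) ^ 2 = ∑ j, |l j - 1| ^ 2 := by simp only [sq_abs]
      _ ≤ (∑ j, |l j - 1|) ^ 2 := Finset.sum_sq_le_sq_sum_of_nonneg fun _ _ => abs_nonneg _
      _ ≤ τ ^ 2 := by
        have : 0 ≤ ∑ j, |l j - 1| := Finset.sum_nonneg fun _ _ => abs_nonneg _
        gcongr
  gcongr

theorem numRows_pos {η ν : ℝ} (hη : 0 < η) (hν : 0 < ν) (hν2 : ν < 2) : 0 < numRows η ν := by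
  have : 0 < Real.log (2 / ν) := Real.log_pos (by rwa [one_lt_div hν])
  exact Nat.ceil_pos.mpr (by positivity)

theorem mainTheorem2 (n d : ℕ) (hd : d ≤ n) (ε δ η ν : ℝ) (hε : 0 < ε) (hδ : 0 < δ)
    (hη : 0 < η) (hν : 0 < ν) (hδ2 : δ < 2) (hν2 : ν < 2)
    (hεδ : ε ≤ max 1 (Real.log (2 / δ)))
    (U : Matrix (Fin n) (Fin d) ℝ → Matrix (Fin n) (Fin n) ℝ)
    (S : Matrix (Fin n) (Fin d) ℝ → Matrix (Fin n) (Fin d) ℝ)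
    (V : Matrix (Fin n) (Fin d) ℝ → Matrix (Fin d) (Fin d) ℝ)
    (hsvd : ∀ A : Matrix (Fin n) (Fin d) ℝ, IsSVD A (U A) (S A) (V A)) :
    IsDifferentiallyPrivate MatrixNeighbors (sanitizedCovariance U S V ε δ η ν) ε δ := by
  intro A A' hA T hT
  rcases le_or_gt 1 δ with hδ1 | hδ1
  · exact (prob_le_one.trans (ENNReal.one_le_ofReal.mpr hδ1)).trans le_add_self
  obtain ⟨u, v, hu, hv, hC⟩ := hA.centerRows_eq_add
  obtain ⟨hw, ht, hτ, htτ, hlog⟩ :=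
    shiftParam_bounds (numRows_pos hη hν hν2) hε hδ hδ1 hεδ rfl rfl rfl
  obtain ⟨P, l, hP, hPl, hl⟩ := exists_diagonalization_of_rank_one_perturbation hw hu hv hC
  have hl0 : ∀ j, 0 ≤ l j := fun j => by
    have h := (Finset.single_le_sum (f := fun j => |l j - 1|) (fun _ _ => abs_nonneg _)
      (Finset.mem_univ j)).trans (hl.trans hτ)
    linarith [(abs_le.mp h).1]
  have hg : Measurable fun x : Fin (numRows η ν) → Fin d → ℝ =>
      sketchCovariance P (Matrix.of x) :=
    (measurable_sketchCovariance P).comp (measurable_matrix_of _ d)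
  have h1 : sanitizedCovariance U S V ε δ η ν A =
      (Measure.pi fun _ => Measure.pi fun j => gaussianReal 0 (l j).toNNReal).map
        (fun x : Fin (numRows η ν) → Fin d → ℝ => sketchCovariance P (Matrix.of x)) := by
    rw [← map_sketchCovariance_diagonal_mul]
    refine map_sketchCovariance_eq_of_covariance_eq ?_
    rw [(hsvd _).covariance_shiftDiag hd, ← hPl, Matrix.transpose_mul, Matrix.diagonal_transpose,
      Matrix.mul_assoc, Matrix.mul_assoc, ← Matrix.mul_assoc (Matrix.diagonal _) _ P,
      Matrix.diagonal_mul_diagonal]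
    simp only [Real.coe_toNNReal _ (hl0 _), Real.mul_self_sqrt (hl0 _)]
  have h2 : sanitizedCovariance U S V ε δ η ν A' =
      (Measure.pi fun _ => Measure.pi fun _ => gaussianReal 0 1).map
        (fun x : Fin (numRows η ν) → Fin d → ℝ => sketchCovariance P (Matrix.of x)) := by
    change _ = Measure.map (sketchCovariance P ∘ Matrix.of) _
    rw [← Measure.map_map (measurable_sketchCovariance P) (measurable_matrix_of _ d)]
    refine map_sketchCovariance_eq_of_covariance_eq ?_
    rw [(hsvd _).covariance_shiftDiag hd, hP]
  -- The post-processing map is common to both inputs, so it suffices to compare the Gaussian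
  -- samples on the preimage of `T`.
  rw [h1, h2, Measure.map_apply hg hT, Measure.map_apply hg hT]
  refine DensityMomentLE.measure_le ht ?_ (hg hT)
  refine (densityMomentLE_pi_gaussianReal ht.le hl hτ htτ).mono (ENNReal.ofReal_le_ofReal ?_)
  -- With `t = ln(2/δ) / ε` the allowed moment `exp (t ε) δ` is exactly `2`.
  rw [div_mul_cancel₀ _ hε.ne', Real.exp_log (by positivity), div_mul_cancel₀ _ hδ.ne',
    ← Real.le_log_iff_exp_le two_pos]
  exact hlog
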